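/- Let $\xi=(\xi_1,\xi_2,\ldots)$ be a sequence of integrable real random variables on a probability space $(\Omega,\mathcal F,\mathbf P)$. Assume that (i) $\xi$ is symmetric, that is, the sequences $\xi$ and $-\xi$ have the same distribution; (ii) $\xi$ is swap-invariant, that is, for every finite subsequence $(\xi_{k_1},\ldots,\xi_{k_d})$ with $k_1<\cdots<k_d$, all vectors obtained from it by permuting its coordinates are zonoid equivalent, where integrable random vectors $X$ and $Y$ in $\mathbb R^d$ are called zonoid equivalent if $\mathbf E|\langle u,X\rangle|=\mathbf E|\langle u,Y\rangle|$ for all $u\in\mathbb R^d$; (iii) $\xi_1\neq 0$ almost surely. Let $\tilde\xi=(\xi_2/|\xi_1|,\xi_3/|\xi_1|,\ldots)$ (defined arbitrarily, say as $0$, on the null event $\{\xi_1=0\}$), and let $\mathcal E_{\tilde\xi}$ be its exchangeable $\sigma$-algebra, which consists of all events $\{\tilde\xi\in B\}$ where $B\subseteq\mathbb R^{\infty}$ is a Borel set invariant under all permutations of finitely many coordinates. Then $\mathbf E(|\xi_1|\mid\mathcal E_{\tilde\xi})>0$ almost surely, the random variable $$X=\frac{|\xi_1|}{\mathbf E(|\xi_1|\mid\mathcal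 E_{\tilde\xi})}\,\mathbf E(\xi_2\mid\mathcal E_{\tilde\xi})$$ is integrable, and $$\frac1n\sum_{i=1}^n\xi_i\longrightarrow X\qquad\text{almost surely and in }L^1\text{ as }n\to\infty .$$ -/

import Mathlib

open MeasureTheory ProbabilityTheory Filter
open scoped Topology

noncomputable section

namespace Zonoid

/-- Two integrable random vectors in `ℝ^d` (possibly on different probability spaces) are zonoid
equivalent if `E|⟨u, X⟩| = E|⟨u, Y⟩|` for every `u ∈ ℝ^d`. -/
def ZonoidEquivalent {Ω Ω' : Type*} [MeasurableSpace Ω] [MeasurableSpace Ω'] {d : ℕ}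
    (X : Ω → Fin d → ℝ) (Y : Ω' → Fin d → ℝ) (μ : Measure Ω) (ν : Measure Ω') : Prop :=
  Integrable X μ ∧ Integrable Y ν ∧
    ∀ u : Fin d → ℝ, ∫ ω, |u ⬝ᵥ X ω| ∂μ = ∫ ω, |u ⬝ᵥ Y ω| ∂ν

/-- An integrable random vector is swap-invariant if all random vectors obtained by permuting its
coordinates are zonoid equivalent. -/
def SwapInvariantVector {Ω : Type*} [MeasurableSpace Ω] {d : ℕ}
    (X : Ω → Fin d → ℝ) (μ : Measure Ω) : Prop :=
  Integrable X μ ∧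
    ∀ σ τ : Equiv.Perm (Fin d), ZonoidEquivalent (fun ω j => X ω (σ j)) (fun ω j => X ω (τ j)) μ μ

/-- A sequence of integrable random variables is swap-invariant if all its finite subsequences
`(ξ_{k_1}, …, ξ_{k_d})`, `k_1 < ⋯ < k_d`, are swap-invariant. -/
def SwapInvariant {Ω : Type*} [MeasurableSpace Ω] (ξ : ℕ → Ω → ℝ) (μ : Measure Ω) : Prop :=
  (∀ i, Integrable (ξ i) μ) ∧
    ∀ (d : ℕ) (k : Fin d → ℕ), StrictMono k → SwapInvariantVector (fun ω j => ξ (k j) ω) μ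

/-- A random sequence is symmetric if `ξ` and `-ξ` have the same distribution in `ℝ^∞`
(jointly, not only coordinate by coordinate). -/
def SymmetricSequence {Ω : Type*} [MeasurableSpace Ω] (ξ : ℕ → Ω → ℝ) (μ : Measure Ω) : Prop :=
  IdentDistrib (fun ω i => ξ i ω) (fun ω i => -ξ i ω) μ μ

/-- The σ-algebra on `ℝ^∞` of the Borel sets that are invariant under every permutation of
finitely many coordinates. -/
@[reducible] def permInvariantSets : MeasurableSpace (ℕ → ℝ) where
  MeasurableSet' B := MeasurableSet B ∧
    ∀ π : Equiv.Perm ℕ, {n | π n ≠ n}.Finite → (fun x : ℕ → ℝ => x ∘ π) ⁻¹' B = B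
  measurableSet_empty := ⟨MeasurableSet.empty, fun _ _ => rfl⟩
  measurableSet_compl B hB := ⟨hB.1.compl, fun π hπ => by rw [Set.preimage_compl, hB.2 π hπ]⟩
  measurableSet_iUnion f hf := ⟨MeasurableSet.iUnion fun i => (hf i).1, fun π hπ => by
    rw [Set.preimage_iUnion]
    exact Set.iUnion_congr fun i => (hf i).2 π hπ⟩

/-- The exchangeable (permutation-invariant) σ-algebra of a random sequence `X`: all events
`{X ∈ B}` with `B` a Borel set of `ℝ^∞` invariant under finite permutations. -/
@[reducible] def exchangeableSigmaAlgebra {Ω : Type*} (X : ℕ → Ω → ℝ) : MeasurableSpace Ω :=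
  permInvariantSets.comap fun ω i => X i ω

/-- The sequence `(ξ_2/|ξ_1|, ξ_3/|ξ_1|, …)`; here `ξ 0` plays the role of `ξ_1`. -/
def normalizedSequence {Ω : Type*} (ξ : ℕ → Ω → ℝ) : ℕ → Ω → ℝ :=
  fun i ω => ξ (i + 1) ω / |ξ 0 ω|

/-- The random variable `|ξ_1| / E(|ξ_1| | 𝓔) * E(ξ_2 | 𝓔)`, where `𝓔` is the exchangeable
σ-algebra of `(ξ_2/|ξ_1|, ξ_3/|ξ_1|, …)`. -/
def ergodicLimit {Ω : Type*} [MeasurableSpace Ω] (ξ : ℕ → Ω → ℝ) (μ : Measure Ω) : Ω → ℝ :=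
  fun ω =>
    |ξ 0 ω| / (μ[fun ω' => |ξ 0 ω'| | exchangeableSigmaAlgebra (normalizedSequence ξ)]) ω
      * (μ[ξ 1 | exchangeableSigmaAlgebra (normalizedSequence ξ)]) ω

end Zonoid

end

/-!
Let `w = |ξ 0|`, let `Q = w · μ` be the tilted measure, and let `ζ i = ξ (i + 1) / |ξ 0|` be the
normalized sequence. The point is that `ζ` is exchangeable under `Q`, although `ξ` need not be
exchangeable under `μ`.

Swap-invariance gives the invariance of
`∫ |t + ∑ u i * (ξ (i + 1) / ξ 0)| ∂Q = ∫ |t * ξ 0 + ∑ u i * ξ (i + 1)| ∂μ` under transpositions of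
the indices `i`. The integrals on the left determine the law of the ratios `ξ (i + 1) / ξ 0` under
`Q`: in the variable `t`, the right derivative of `∫ |t + Y| ∂Q` gives the distribution function of
`Y`, and the laws of all linear forms `Y = ∑ u i * (ξ (i + 1) / ξ 0)` give the joint law
(`measure_ext_of_integral_abs_add_sum_range`). So the ratios are exchangeable under `Q`. They differ
from `ζ` only by the common sign of `ξ 0`; as `ζ` is symmetric under `Q`, its law is the
symmetrization of the law of the ratios and is exchangeable as well
(`isExchangeable_map_normalizedSequence`).

For an exchangeable measure the averages `avg n` of the coordinates form a reverse martingale. They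
are Cauchy in `L¹`, since truncating the coordinates reduces this to a variance computation, and
Doob's maximal inequality, applied with time reversed, turns convergence in `L¹` into almost sure
convergence. The limit `Z` is invariant and has the integrals of the first coordinate over invariant
sets (`IsExchangeable.strong_law`).

Since `w ≠ 0` almost surely, `Q` and `μ` have the same null sets and the averages of `ξ` converge to
`w * z` with `z = Z ∘ ζ`, in `L¹(μ)` too, as `L¹(Q)` is `L¹(μ)` with weight `w`. With `𝓔` the
exchangeable `σ`-algebra of `ζ`, the equality of the integrals of `Z` and of the first coordinate
says `E(w z | 𝓔) = E(ξ 1 | 𝓔)`; pulling out the `𝓔`-measurable `z` yields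
`z = E(ξ 1 | 𝓔) / E(w | 𝓔)`.
-/

namespace Zonoid

open scoped NNReal ENNReal

/-! ### Reverse martingales -/

section ReverseMartingale

variable {Ω : Type*} {mΩ : MeasurableSpace Ω} {ν : Measure Ω} [IsFiniteMeasure ν]

/-- Finite-horizon form: reversing time on `{n, …, n + m}` turns the reverse martingale into a
martingale, whose last value is the conditional expectation given `𝓔 n`. -/
lemma measure_exists_le_abs_condExp_le_of_le {𝓔 : ℕ → MeasurableSpace Ω} (h𝓔 : Antitone 𝓔)
    (hle : ∀ n, 𝓔 n ≤ mΩ) (f : Ω → ℝ) (n m : ℕ) (ε : ℝ≥0) :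
    ε * ν {ω | ∃ k ≤ m, (ε : ℝ) ≤ |(ν[f | 𝓔 (n + k)]) ω|} ≤
      ENNReal.ofReal (∫ ω, |(ν[f | 𝓔 n]) ω| ∂ν) := by
  let 𝒢 : Filtration ℕ mΩ :=
    { seq := fun j => 𝓔 (n + (m - j))
      mono' := fun i j hij => h𝓔 (by omega)
      le' := fun j => hle _ }
  have hM : Martingale (fun j => ν[f | 𝒢 j]) 𝒢 ν := martingale_condExp f 𝒢 ν
  have hsub : Submartingale ((fun j => ν[f | 𝒢 j]) ⊔ -(fun j => ν[f | 𝒢 j])) 𝒢 ν :=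
    hM.submartingale.sup hM.neg.submartingale
  have hsub' : Submartingale (fun j ω => |(ν[f | 𝒢 j]) ω|) 𝒢 ν := hsub
  have key := maximal_ineq hsub' (fun j ω => abs_nonneg _) (ε := ε) m
  have hset : {ω | ∃ k ≤ m, (ε : ℝ) ≤ |(ν[f | 𝓔 (n + k)]) ω|} ⊆
      {ω | (ε : ℝ) ≤ (Finset.range (m + 1)).sup' Finset.nonempty_range_add_one
        fun k => |(ν[f | 𝒢 k]) ω|} := by
    rintro ω ⟨k, hk, h⟩
    have hmem : m - k ∈ Finset.range (m + 1) := Finset.mem_range.2 (by omega)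
    have hle' := Finset.le_sup' (fun k => |(ν[f | 𝒢 k]) ω|) hmem
    refine le_trans ?_ hle'
    have : m - (m - k) = k := by omega
    change (ε : ℝ) ≤ |(ν[f | 𝓔 (n + (m - (m - k)))]) ω|
    rwa [this]
  refine (mul_le_mul_right (measure_mono hset) _).trans (key.trans ?_)
  refine ENNReal.ofReal_le_ofReal ?_
  have h𝒢 : 𝒢 m = 𝓔 n := by
    change 𝓔 (n + (m - m)) = 𝓔 n
    simp
  rw [h𝒢]
  exact setIntegral_le_integral integrable_condExp.abs (ae_of_all _ fun ω => abs_nonneg _)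

/-- Doob's maximal inequality for a reverse martingale. -/
lemma measure_exists_le_abs_condExp_le {𝓔 : ℕ → MeasurableSpace Ω} (h𝓔 : Antitone 𝓔)
    (hle : ∀ n, 𝓔 n ≤ mΩ) (f : Ω → ℝ) (n : ℕ) (ε : ℝ≥0) :
    ε * ν {ω | ∃ k, (ε : ℝ) ≤ |(ν[f | 𝓔 (n + k)]) ω|} ≤
      ENNReal.ofReal (∫ ω, |(ν[f | 𝓔 n]) ω| ∂ν) := by
  have hU : {ω | ∃ k, (ε : ℝ) ≤ |(ν[f | 𝓔 (n + k)]) ω|} =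
      ⋃ m, {ω | ∃ k ≤ m, (ε : ℝ) ≤ |(ν[f | 𝓔 (n + k)]) ω|} := by
    ext ω
    simp only [Set.mem_ofPred_eq, Set.mem_iUnion]
    exact ⟨fun ⟨k, h⟩ => ⟨k, k, le_rfl, h⟩, fun ⟨_, k, _, h⟩ => ⟨k, h⟩⟩
  have hmono : Monotone fun m => {ω | ∃ k ≤ m, (ε : ℝ) ≤ |(ν[f | 𝓔 (n + k)]) ω|} :=
    fun a b hab ω ⟨k, hk, h⟩ => ⟨k, hk.trans hab, h⟩
  rw [hU, hmono.measure_iUnion, ENNReal.mul_iSup]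
  exact iSup_le fun m => measure_exists_le_abs_condExp_le_of_le h𝓔 hle f n m ε

/-- A reverse martingale that tends to zero in `L¹` tends to zero almost surely. -/
lemma ae_tendsto_condExp_zero_of_integral {𝓔 : ℕ → MeasurableSpace Ω} (h𝓔 : Antitone 𝓔)
    (hle : ∀ n, 𝓔 n ≤ mΩ) (f : Ω → ℝ)
    (h0 : Tendsto (fun n => ∫ ω, |(ν[f | 𝓔 n]) ω| ∂ν) atTop (𝓝 0)) :
    ∀ᵐ ω ∂ν, Tendsto (fun n => (ν[f | 𝓔 n]) ω) atTop (𝓝 0) := by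
  have hε : ∀ ε : ℝ≥0, 0 < ε →
      ν {ω | ∀ n, ∃ k, (ε : ℝ) ≤ |(ν[f | 𝓔 (n + k)]) ω|} = 0 := by
    intro ε hε
    have hbound : ∀ n, ε * ν {ω | ∀ n, ∃ k, (ε : ℝ) ≤ |(ν[f | 𝓔 (n + k)]) ω|} ≤
        ENNReal.ofReal (∫ ω, |(ν[f | 𝓔 n]) ω| ∂ν) := fun n => by
      have hsub : {ω | ∀ n, ∃ k, (ε : ℝ) ≤ |(ν[f | 𝓔 (n + k)]) ω|} ⊆
          {ω | ∃ k, (ε : ℝ) ≤ |(ν[f | 𝓔 (n + k)]) ω|} := fun ω h => h n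
      exact (mul_le_mul_right (measure_mono hsub) _).trans
        (measure_exists_le_abs_condExp_le h𝓔 hle f n ε)
    have hlim := ENNReal.tendsto_ofReal h0
    rw [ENNReal.ofReal_zero] at hlim
    have := ge_of_tendsto' hlim hbound
    simpa [hε.ne'] using this
  have hall : ∀ᵐ ω ∂ν, ∀ j : ℕ, ¬ ∀ n, ∃ k,
      ((1 / ((j : ℝ≥0) + 1) : ℝ≥0) : ℝ) ≤ |(ν[f | 𝓔 (n + k)]) ω| := by
    refine ae_all_iff.2 fun j => ?_
    have := hε (1 / ((j : ℝ≥0) + 1)) (by positivity)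
    rw [ae_iff]
    simpa using this
  filter_upwards [hall] with ω hω
  rw [Metric.tendsto_atTop]
  intro δ hδ
  obtain ⟨j, hj⟩ := exists_nat_one_div_lt hδ
  have := hω j
  push Not at this
  obtain ⟨N, hN⟩ := this
  refine ⟨N, fun n hn => ?_⟩
  obtain ⟨k, rfl⟩ := Nat.exists_eq_add_of_le hn
  rw [Real.dist_eq, sub_zero]
  refine (hN k).trans ?_
  push_cast
  exact hj

end ReverseMartingale

/-! ### Exchangeable measures and averages of coordinates -/

section Exchangeable

/-- A measure on `ℝ^∞` is exchangeable if it is invariant under transpositions of coordinates;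
these generate the permutations of finitely many coordinates. -/
def IsExchangeable (ν : Measure (ℕ → ℝ)) : Prop :=
  ∀ a b : ℕ, ν.map (fun x => x ∘ Equiv.swap a b) = ν

/-- The average of the first `n` coordinates; it is `0` for `n = 0`. -/
noncomputable def avg (n : ℕ) (x : ℕ → ℝ) : ℝ := (n : ℝ)⁻¹ * ∑ i ∈ Finset.range n, x i

/-- The Borel sets of `ℝ^∞` that are invariant under the transpositions `(0 i)` with `i < n`, that
is, under all permutations of the first `n` coordinates. -/
@[reducible] def initialInvariantSets (n : ℕ) : MeasurableSpace (ℕ → ℝ) where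
  MeasurableSet' B := MeasurableSet B ∧
    ∀ i < n, (fun x : ℕ → ℝ => x ∘ Equiv.swap 0 i) ⁻¹' B = B
  measurableSet_empty := ⟨MeasurableSet.empty, fun _ _ => rfl⟩
  measurableSet_compl B hB := ⟨hB.1.compl, fun i hi => by rw [Set.preimage_compl, hB.2 i hi]⟩
  measurableSet_iUnion f hf := ⟨MeasurableSet.iUnion fun i => (hf i).1, fun i hi => by
    rw [Set.preimage_iUnion]
    exact Set.iUnion_congr fun j => (hf j).2 i hi⟩

lemma initialInvariantSets_le (n : ℕ) : initialInvariantSets n ≤ MeasurableSpace.pi :=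
  fun _ hB => hB.1

lemma antitone_initialInvariantSets : Antitone initialInvariantSets :=
  fun _ _ hmn _ hB => ⟨hB.1, fun i hi => hB.2 i (hi.trans_le hmn)⟩

lemma permInvariantSets_le_initial (n : ℕ) : permInvariantSets ≤ initialInvariantSets n :=
  fun _ hB => ⟨hB.1, fun i _ => hB.2 _ <|
    (Set.toFinite {0, i}).subset fun j hj => by
      by_contra h
      simp only [Set.mem_insert_iff, Set.mem_singleton_iff, not_or] at h
      exact hj (Equiv.swap_apply_of_ne_of_ne h.1 h.2)⟩

lemma permInvariantSets_le : permInvariantSets ≤ MeasurableSpace.pi := fun _ hB => hB.1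

lemma measurable_avg (n : ℕ) : Measurable (avg n) := by
  unfold avg; fun_prop

/-- Composition with a transposition as a measurable equivalence, which makes the change of
variables available for arbitrary integrands. -/
def swapEquiv (a b : ℕ) : (ℕ → ℝ) ≃ᵐ (ℕ → ℝ) where
  toFun x := x ∘ Equiv.swap a b
  invFun x := x ∘ Equiv.swap a b
  left_inv x := by ext; simp
  right_inv x := by ext; simp
  measurable_toFun := by
    refine measurable_pi_lambda _ fun i => ?_
    exact measurable_pi_apply (Equiv.swap a b i)
  measurable_invFun := by
    refine measurable_pi_lambda _ fun i => ?_
    exact measurable_pi_apply (Equiv.swap a b i)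

lemma measurable_initialInvariantSets {n : ℕ} {g : (ℕ → ℝ) → ℝ} (hg : Measurable g)
    (hinv : ∀ i < n, ∀ x, g (x ∘ Equiv.swap 0 i) = g x) : Measurable[initialInvariantSets n] g :=
  fun s hs => ⟨hg hs, fun i hi => by
    ext x
    simp [hinv i hi x]⟩

lemma measurable_permInvariantSets {g : (ℕ → ℝ) → ℝ} (hg : Measurable g)
    (hinv : ∀ π : Equiv.Perm ℕ, {n | π n ≠ n}.Finite → ∀ x, g (x ∘ π) = g x) :
    Measurable[permInvariantSets] g :=
  fun s hs => ⟨hg hs, fun π hπ => by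
    ext x
    simp [hinv π hπ x]⟩

lemma avg_comp_perm {n : ℕ} (π : Equiv.Perm ℕ) (hπ : ∀ j, π j ≠ j → j < n) (x : ℕ → ℝ) :
    avg n (x ∘ π) = avg n x := by
  unfold avg
  congr 1
  exact Equiv.Perm.sum_comp π (Finset.range n) x fun j hj => by simpa using hπ j hj

lemma measurable_avg_initialInvariantSets (n : ℕ) : Measurable[initialInvariantSets n] (avg n) :=
  measurable_initialInvariantSets (measurable_avg n) fun i hi x => by
    refine avg_comp_perm _ (fun j hj => ?_) x
    by_contra h
    exact hj (Equiv.swap_apply_of_ne_of_ne (by omega) (by omega))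

variable {ν : Measure (ℕ → ℝ)}

lemma IsExchangeable.integral_swap (hν : IsExchangeable ν) (a b : ℕ) (g : (ℕ → ℝ) → ℝ) :
    ∫ x, g (x ∘ Equiv.swap a b) ∂ν = ∫ x, g x ∂ν := by
  conv_rhs => rw [← hν a b]
  exact ((swapEquiv a b).measurableEmbedding.integral_map g).symm

lemma IsExchangeable.integrable_swap (hν : IsExchangeable ν) (a b : ℕ) {g : (ℕ → ℝ) → ℝ}
    (hg : Integrable g ν) : Integrable (fun x => g (x ∘ Equiv.swap a b)) ν := by
  rw [← hν a b] at hg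
  exact ((swapEquiv a b).measurableEmbedding.integrable_map_iff).1 hg

lemma IsExchangeable.integrable_coord (hν : IsExchangeable ν)
    (h0 : Integrable (fun x : ℕ → ℝ => x 0) ν) (i : ℕ) :
    Integrable (fun x : ℕ → ℝ => x i) ν := by
  simpa using hν.integrable_swap 0 i h0

lemma IsExchangeable.integrable_avg (hν : IsExchangeable ν)
    (h0 : Integrable (fun x : ℕ → ℝ => x 0) ν) (n : ℕ) : Integrable (avg n) ν :=
  (integrable_finsetSum _ fun i _ => hν.integrable_coord h0 i).const_mul _

lemma IsExchangeable.setIntegral_coord (hν : IsExchangeable ν) {n : ℕ} {B : Set (ℕ → ℝ)}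
    (hB : MeasurableSet[initialInvariantSets n] B) {i : ℕ} (hi : i < n) :
    ∫ x in B, x i ∂ν = ∫ x in B, x 0 ∂ν := by
  have := hν.integral_swap 0 i (B.indicator fun x => x 0)
  rw [integral_indicator hB.1] at this
  rw [← this, ← integral_indicator hB.1]
  congr 1
  ext x
  have hx : x ∘ Equiv.swap 0 i ∈ B ↔ x ∈ B := by
    conv_rhs => rw [← hB.2 i hi]
    rfl
  by_cases h : x ∈ B <;> simp [hx, h, Set.indicator]

lemma IsExchangeable.setIntegral_avg (hν : IsExchangeable ν)
    (h0 : Integrable (fun x : ℕ → ℝ => x 0) ν) {n : ℕ} (hn : 0 < n) {B : Set (ℕ → ℝ)}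
    (hB : MeasurableSet[initialInvariantSets n] B) :
    ∫ x in B, avg n x ∂ν = ∫ x in B, x 0 ∂ν := by
  unfold avg
  rw [integral_const_mul, integral_finsetSum _ fun i _ => (hν.integrable_coord h0 i).integrableOn,
    Finset.sum_congr rfl fun i hi => hν.setIntegral_coord hB (Finset.mem_range.1 hi)]
  have : (n : ℝ) ≠ 0 := by positivity
  simp [this]

/-- The averages of an exchangeable sequence form a reverse martingale. -/
lemma IsExchangeable.condExp_coord_zero [IsFiniteMeasure ν] (hν : IsExchangeable ν)
    (h0 : Integrable (fun x : ℕ → ℝ => x 0) ν) {n : ℕ} (hn : 0 < n) :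
    avg n =ᵐ[ν] ν[fun x => x 0 | initialInvariantSets n] :=
  ae_eq_condExp_of_forall_setIntegral_eq (initialInvariantSets_le n) h0
    (fun _ _ _ => (hν.integrable_avg h0 n).integrableOn)
    (fun _ hB _ => hν.setIntegral_avg h0 hn hB)
    (measurable_avg_initialInvariantSets n).stronglyMeasurable.aestronglyMeasurable

end Exchangeable

/-! ### Convergence in mean -/

section Completeness

variable {Ω : Type*} {mΩ : MeasurableSpace Ω} {μ : Measure Ω}

lemma dist_toL1_eq_integral_abs_sub {f g : Ω → ℝ} (hf : Integrable f μ) (hg : Integrable g μ) :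
    dist (hf.toL1 f) (hg.toL1 g) = ∫ ω, |f ω - g ω| ∂μ := by
  rw [dist_eq_norm, ← Integrable.toL1_sub, L1.norm_eq_integral_norm]
  refine integral_congr_ae ?_
  filter_upwards [Integrable.coeFn_toL1 (hf.sub hg)] with ω hω
  rw [hω, Pi.sub_apply, Real.norm_eq_abs]

/-- Completeness of `L¹`, stated for functions instead of their classes. -/
lemma exists_tendsto_integral_abs_sub {F : ℕ → Ω → ℝ} (hF : ∀ n, Integrable (F n) μ)
    (hC : ∀ ε > 0, ∃ N, ∀ n m, N ≤ n → n ≤ m → ∫ ω, |F n ω - F m ω| ∂μ < ε) :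
    ∃ G : Ω → ℝ, Integrable G μ ∧ Tendsto (fun n => ∫ ω, |F n ω - G ω| ∂μ) atTop (𝓝 0) := by
  have hcauchy : CauchySeq fun n => (hF n).toL1 (F n) := by
    rw [Metric.cauchySeq_iff']
    intro ε hε
    obtain ⟨N, hN⟩ := hC ε hε
    refine ⟨N, fun n hn => ?_⟩
    rw [dist_comm, dist_toL1_eq_integral_abs_sub]
    exact hN N n le_rfl hn
  obtain ⟨G, hG⟩ := cauchySeq_tendsto_of_complete hcauchy
  have hGi : Integrable G μ := L1.integrable_coeFn G
  refine ⟨G, hGi, ?_⟩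
  have := tendsto_iff_dist_tendsto_zero.1 hG
  refine this.congr fun n => ?_
  rw [← dist_toL1_eq_integral_abs_sub (hF n) hGi, Integrable.toL1_coeFn]

lemma exists_seq_ae_tendsto_of_integral {F : ℕ → Ω → ℝ} (hF : ∀ n, Integrable (F n) μ)
    {G : Ω → ℝ} (hG : Integrable G μ)
    (h : Tendsto (fun n => ∫ ω, |F n ω - G ω| ∂μ) atTop (𝓝 0)) :
    ∃ ns : ℕ → ℕ, StrictMono ns ∧
      ∀ᵐ ω ∂μ, Tendsto (fun k => F (ns k) ω) atTop (𝓝 (G ω)) := by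
  refine (tendstoInMeasure_of_tendsto_eLpNorm (p := 1) one_ne_zero
    (fun n => (hF n).aestronglyMeasurable) hG.aestronglyMeasurable ?_).exists_seq_tendsto_ae
  have h' := ENNReal.tendsto_ofReal h
  rw [ENNReal.ofReal_zero] at h'
  refine h'.congr fun n => ?_
  rw [eLpNorm_one_eq_lintegral_enorm, ← ofReal_integral_norm_eq_lintegral_enorm ((hF n).sub hG)]
  rfl

end Completeness

/-! ### The strong law for exchangeable measures -/

section StrongLaw

variable {ν : Measure (ℕ → ℝ)}

lemma avg_sub (n : ℕ) (x y : ℕ → ℝ) : avg n x - avg n y = avg n (x - y) := by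
  simp [avg, mul_sub, Finset.sum_sub_distrib]

lemma abs_avg_le (n : ℕ) (x : ℕ → ℝ) : |avg n x| ≤ avg n fun i => |x i| := by
  unfold avg
  rw [abs_mul, abs_of_nonneg (by positivity : (0 : ℝ) ≤ (n : ℝ)⁻¹)]
  gcongr
  exact Finset.abs_sum_le_sum_abs _ _

lemma IsExchangeable.integral_mul_of_ne (hν : IsExchangeable ν) (f : ℝ → ℝ) {i j : ℕ}
    (hij : i ≠ j) : ∫ x, f (x i) * f (x j) ∂ν = ∫ x, f (x 0) * f (x 1) ∂ν := by
  rw [← hν.integral_swap 0 i]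
  have hj : Equiv.swap 0 i j ≠ 0 := fun h => hij (by
    have := congrArg (Equiv.swap 0 i) h
    simpa using this.symm)
  rw [← hν.integral_swap 1 (Equiv.swap 0 i j)]
  simp only [Function.comp_apply, Equiv.swap_apply_right]
  rw [Equiv.swap_apply_of_ne_of_ne zero_ne_one hj.symm]

lemma IsExchangeable.integral_mul_self (hν : IsExchangeable ν) (f : ℝ → ℝ) (i : ℕ) :
    ∫ x, f (x i) * f (x i) ∂ν = ∫ x, f (x 0) * f (x 0) ∂ν := by
  rw [← hν.integral_swap 0 i]
  simp

variable [IsFiniteMeasure ν]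

lemma integrable_comp_mul_comp {f : ℝ → ℝ} (hf : Measurable f) {C : ℝ} (hC : ∀ t, |f t| ≤ C)
    (i j : ℕ) : Integrable (fun x : ℕ → ℝ => f (x i) * f (x j)) ν := by
  refine Integrable.of_bound (by fun_prop) (C * C) (ae_of_all _ fun x => ?_)
  rw [norm_mul]
  exact mul_le_mul (hC _) (hC _) (norm_nonneg _) ((abs_nonneg _).trans (hC 0))

/-- Only the diagonal terms of the double sum differ from the off-diagonal constant. -/
lemma IsExchangeable.integral_avg_mul_avg (hν : IsExchangeable ν) {f : ℝ → ℝ} (hf : Measurable f)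
    {C : ℝ} (hC : ∀ t, |f t| ≤ C) {n m : ℕ} (hn : 0 < n) (hnm : n ≤ m) :
    ∫ x, avg n (f ∘ x) * avg m (f ∘ x) ∂ν =
      ∫ x, f (x 0) * f (x 1) ∂ν +
        (∫ x, f (x 0) * f (x 0) ∂ν - ∫ x, f (x 0) * f (x 1) ∂ν) / m := by
  set c := ∫ x, f (x 0) * f (x 1) ∂ν with hc
  set s := ∫ x, f (x 0) * f (x 0) ∂ν with hs
  have hij : ∀ i j, ∫ x, f (x i) * f (x j) ∂ν = c + if i = j then s - c else 0 := by
    intro i j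
    by_cases h : i = j
    · subst h
      rw [hν.integral_mul_self f i, if_pos rfl, ← hs]
      ring
    · rw [hν.integral_mul_of_ne f h, if_neg h, add_zero]
  have hexp : ∀ x : ℕ → ℝ, avg n (f ∘ x) * avg m (f ∘ x) = ((n : ℝ)⁻¹ * (m : ℝ)⁻¹) *
      ∑ i ∈ Finset.range n, ∑ j ∈ Finset.range m, f (x i) * f (x j) := by
    intro x
    simp only [avg, Function.comp_apply]
    rw [← Finset.sum_mul_sum]
    ring
  simp_rw [hexp]
  rw [integral_const_mul, integral_finsetSum _ fun i _ =>
    integrable_finsetSum _ fun j _ => integrable_comp_mul_comp hf hC i j]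
  have hinner : ∀ i ∈ Finset.range n,
      ∫ x, ∑ j ∈ Finset.range m, f (x i) * f (x j) ∂ν = m * c + (s - c) := by
    intro i hi
    have him : i < m := (Finset.mem_range.1 hi).trans_le hnm
    rw [integral_finsetSum _ fun j _ => integrable_comp_mul_comp hf hC i j]
    simp_rw [hij]
    rw [Finset.sum_add_distrib, Finset.sum_ite_eq]
    simp [him]
  rw [Finset.sum_congr rfl hinner]
  have hn' : (n : ℝ) ≠ 0 := by positivity
  have hm' : (m : ℝ) ≠ 0 := by
    have := hn.trans_le hnm
    positivity
  simp only [Finset.sum_const, Finset.card_range, nsmul_eq_mul]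
  field_simp

lemma abs_avg_comp_le {f : ℝ → ℝ} {C : ℝ} (hC : ∀ t, |f t| ≤ C) (n : ℕ) (x : ℕ → ℝ) :
    |avg n (f ∘ x)| ≤ C := by
  have h0 : 0 ≤ C := (abs_nonneg _).trans (hC 0)
  refine (abs_avg_le n _).trans ?_
  unfold avg
  calc (n : ℝ)⁻¹ * ∑ i ∈ Finset.range n, |(f ∘ x) i|
      ≤ (n : ℝ)⁻¹ * ∑ _i ∈ Finset.range n, C := by
        gcongr
        exact hC _
    _ ≤ C := by
        rcases Nat.eq_zero_or_pos n with rfl | hn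
        · simpa using h0
        · have : (n : ℝ) ≠ 0 := by positivity
          simp [this]

lemma measurable_avg_comp {f : ℝ → ℝ} (hf : Measurable f) (n : ℕ) :
    Measurable fun x : ℕ → ℝ => avg n (f ∘ x) := by
  simp only [avg, Function.comp_apply]
  fun_prop

lemma integrable_avg_comp {f : ℝ → ℝ} (hf : Measurable f) {C : ℝ} (hC : ∀ t, |f t| ≤ C) (n : ℕ) :
    Integrable (fun x : ℕ → ℝ => avg n (f ∘ x)) ν :=
  Integrable.of_bound (measurable_avg_comp hf n).aestronglyMeasurable C
    (ae_of_all _ fun x => abs_avg_comp_le hC n x)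

/-- The averages of a bounded function of the coordinates are Cauchy in `L²`. -/
lemma IsExchangeable.integral_sq_avg_sub_avg (hν : IsExchangeable ν) {f : ℝ → ℝ}
    (hf : Measurable f) {C : ℝ} (hC : ∀ t, |f t| ≤ C) {n m : ℕ} (hn : 0 < n) (hnm : n ≤ m) :
    ∫ x, (avg n (f ∘ x) - avg m (f ∘ x)) ^ 2 ∂ν =
      (∫ x, f (x 0) * f (x 0) ∂ν - ∫ x, f (x 0) * f (x 1) ∂ν) * ((n : ℝ)⁻¹ - (m : ℝ)⁻¹) := by
  have hi : ∀ k l, Integrable (fun x : ℕ → ℝ => avg k (f ∘ x) * avg l (f ∘ x)) ν := fun k l => by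
    refine Integrable.of_bound
      ((measurable_avg_comp hf k).mul (measurable_avg_comp hf l)).aestronglyMeasurable (C * C)
      (ae_of_all _ fun x => ?_)
    rw [norm_mul]
    exact mul_le_mul (abs_avg_comp_le hC _ _) (abs_avg_comp_le hC _ _) (norm_nonneg _)
      ((abs_nonneg _).trans (hC 0))
  have hexp : ∀ x : ℕ → ℝ, (avg n (f ∘ x) - avg m (f ∘ x)) ^ 2 =
      avg n (f ∘ x) * avg n (f ∘ x) - 2 * (avg n (f ∘ x) * avg m (f ∘ x)) +
        avg m (f ∘ x) * avg m (f ∘ x) := fun x => by ring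
  simp_rw [hexp]
  have h2 : Integrable (fun x : ℕ → ℝ =>
      avg n (f ∘ x) * avg n (f ∘ x) - 2 * (avg n (f ∘ x) * avg m (f ∘ x))) ν :=
    (hi n n).sub ((hi n m).const_mul 2)
  rw [integral_add h2 (hi m m), integral_sub (hi n n) ((hi n m).const_mul 2), integral_const_mul,
    hν.integral_avg_mul_avg hf hC hn le_rfl, hν.integral_avg_mul_avg hf hC hn hnm,
    hν.integral_avg_mul_avg hf hC (hn.trans_le hnm) le_rfl]
  ring

/-- Averaging contracts the `L¹` distance between two functions of the coordinates. -/
lemma IsExchangeable.integral_abs_avg_sub_avg_comp_le (hν : IsExchangeable ν)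
    (h0 : Integrable (fun x : ℕ → ℝ => x 0) ν) {f : ℝ → ℝ} (hf : Measurable f) {C : ℝ}
    (hC : ∀ t, |f t| ≤ C) (n : ℕ) :
    ∫ x, |avg n x - avg n (f ∘ x)| ∂ν ≤ ∫ x, |x 0 - f (x 0)| ∂ν := by
  have hfi : Integrable (fun x : ℕ → ℝ => f (x 0)) ν :=
    Integrable.of_bound (hf.comp (measurable_pi_apply 0)).aestronglyMeasurable C
      (ae_of_all _ fun x => hC _)
  have hg0 : Integrable (fun x : ℕ → ℝ => |x 0 - f (x 0)|) ν := (h0.sub hfi).abs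
  have hgi : ∀ i, Integrable (fun x : ℕ → ℝ => |x i - f (x i)|) ν := fun i => by
    simpa using hν.integrable_swap 0 i hg0
  have hint : ∀ i, ∫ x, |x i - f (x i)| ∂ν = ∫ x, |x 0 - f (x 0)| ∂ν := fun i => by
    rw [← hν.integral_swap 0 i fun x => |x i - f (x i)|]
    simp
  calc ∫ x, |avg n x - avg n (f ∘ x)| ∂ν
      ≤ ∫ x, (n : ℝ)⁻¹ * ∑ i ∈ Finset.range n, |x i - f (x i)| ∂ν := by
        refine integral_mono_of_nonneg (ae_of_all _ fun x => abs_nonneg _)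
          ((integrable_finsetSum _ fun i _ => hgi i).const_mul _) (ae_of_all _ fun x => ?_)
        change |avg n x - avg n (f ∘ x)| ≤ _
        rw [avg_sub]
        exact abs_avg_le n _
    _ = (n : ℝ)⁻¹ * (n * ∫ x, |x 0 - f (x 0)| ∂ν) := by
        rw [integral_const_mul, integral_finsetSum _ fun i _ => hgi i]
        simp [hint]
    _ ≤ ∫ x, |x 0 - f (x 0)| ∂ν := by
        have hnn : 0 ≤ ∫ x, |x 0 - f (x 0)| ∂ν := integral_nonneg fun x => abs_nonneg _
        rcases Nat.eq_zero_or_pos n with rfl | hn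
        · simpa using hnn
        · have : (n : ℝ) ≠ 0 := by positivity
          rw [inv_mul_cancel_left₀ this]

/-- An integrable function is approximated in `L¹` by its truncations. -/
lemma exists_truncation {Ω : Type*} [MeasurableSpace Ω] {μ : Measure Ω} {g : Ω → ℝ}
    (hg : Integrable g μ) {ε : ℝ} (hε : 0 < ε) :
    ∃ (f : ℝ → ℝ) (C : ℝ), Measurable f ∧ (∀ t, |f t| ≤ C) ∧ ∫ ω, |g ω - f (g ω)| ∂μ < ε := by
  let f : ℕ → ℝ → ℝ := fun K t => max (-(K : ℝ)) (min K t)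
  have hf : ∀ K, Measurable (f K) := fun K => by fun_prop
  have hlim : Tendsto (fun K : ℕ => ∫ ω, |g ω - f K (g ω)| ∂μ) atTop (𝓝 (∫ _, 0 ∂μ)) := by
    refine tendsto_integral_of_dominated_convergence (fun ω => |g ω|) (fun K => ?_) hg.abs
      (fun K => ae_of_all _ fun ω => ?_) (ae_of_all _ fun ω => ?_)
    · exact (hg.aestronglyMeasurable.aemeasurable.sub
        ((hf K).comp_aemeasurable hg.aestronglyMeasurable.aemeasurable)).abs.aestronglyMeasurable
    · have hK : (0 : ℝ) ≤ K := K.cast_nonneg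
      simp only [f, Real.norm_eq_abs, abs_abs]
      rcases le_total (g ω) 0 with h | h
      · rw [min_eq_right (h.trans hK), abs_of_nonpos h, abs_of_nonpos (by simp)]
        have : max (-(K : ℝ)) (g ω) ≤ 0 := max_le (by linarith) h
        linarith
      · have h1 : 0 ≤ min (K : ℝ) (g ω) := le_min hK h
        rw [max_eq_right (by linarith), abs_of_nonneg h,
          abs_of_nonneg (by linarith [min_le_right (K : ℝ) (g ω)])]
        linarith
    · obtain ⟨N, hN⟩ := exists_nat_ge |g ω|
      refine tendsto_const_nhds.congr' ?_
      filter_upwards [eventually_ge_atTop N] with K hK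
      have hle : |g ω| ≤ K := hN.trans (by exact_mod_cast hK)
      have := abs_le.1 hle
      simp only [f]
      rw [min_eq_right this.2, max_eq_right this.1]
      simp
  rw [integral_zero] at hlim
  obtain ⟨K, hK⟩ := (hlim.eventually_lt_const hε).exists
  refine ⟨f K, K, hf K, fun t => abs_le.2 ⟨le_max_left _ _, max_le ?_ (min_le_left _ _)⟩, hK⟩
  linarith [(K.cast_nonneg : (0 : ℝ) ≤ K)]

/-- The averages are Cauchy in `L¹`: truncation reduces this to the `L²` identity for bounded
functions of the coordinates. -/
lemma IsExchangeable.exists_integral_abs_avg_sub_lt (hν : IsExchangeable ν)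
    (h0 : Integrable (fun x : ℕ → ℝ => x 0) ν) {ε : ℝ} (hε : 0 < ε) :
    ∃ N, ∀ n m, N ≤ n → n ≤ m → ∫ x, |avg n x - avg m x| ∂ν < ε := by
  obtain ⟨f, C, hf, hC, hfε⟩ := exists_truncation h0 (by positivity : 0 < ε / 4)
  set V := |∫ x, f (x 0) * f (x 0) ∂ν - ∫ x, f (x 0) * f (x 1) ∂ν| with hV
  -- `δ` is the weight in `2 |t| ≤ δ + t ^ 2 / δ`, which bounds the `L¹` norm by the `L²` norm.
  set δ := ε / (4 * (ν.real Set.univ + 1)) with hδ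
  have hmass : 0 ≤ ν.real Set.univ := measureReal_nonneg
  have hδ0 : 0 < δ := by positivity
  obtain ⟨N, hN⟩ := exists_nat_gt (4 * V / (δ * ε))
  refine ⟨N + 1, fun n m hn hnm => ?_⟩
  have hn0 : 0 < n := by omega
  have hsq := hν.integral_sq_avg_sub_avg hf hC hn0 hnm
  have hsqi : Integrable (fun x : ℕ → ℝ => (avg n (f ∘ x) - avg m (f ∘ x)) ^ 2) ν := by
    refine Integrable.of_bound
      (((measurable_avg_comp hf n).sub (measurable_avg_comp hf m)).pow_const 2).aestronglyMeasurable
      ((C + C) ^ 2) (ae_of_all _ fun x => ?_)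
    rw [norm_pow]
    refine pow_le_pow_left₀ (norm_nonneg _) ?_ 2
    exact (abs_sub _ _).trans (add_le_add (abs_avg_comp_le hC _ _) (abs_avg_comp_le hC _ _))
  have hL1 : ∫ x, |avg n (f ∘ x) - avg m (f ∘ x)| ∂ν ≤ (δ * ν.real Set.univ + V / (n * δ)) / 2 := by
    calc ∫ x, |avg n (f ∘ x) - avg m (f ∘ x)| ∂ν
        ≤ ∫ x, (δ + (avg n (f ∘ x) - avg m (f ∘ x)) ^ 2 / δ) / 2 ∂ν := by
          refine integral_mono_of_nonneg (ae_of_all _ fun x => abs_nonneg _)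
            (((integrable_const δ).add (hsqi.div_const δ)).div_const 2) (ae_of_all _ fun x => ?_)
          change |avg n (f ∘ x) - avg m (f ∘ x)| ≤ _
          rw [le_div_iff₀ two_pos, ← sq_abs, ← sub_nonneg]
          generalize |avg n (f ∘ x) - avg m (f ∘ x)| = t
          have : δ + t ^ 2 / δ - t * 2 = (δ - t) ^ 2 / δ := by field_simp; ring
          rw [this]
          positivity
      _ = (δ * ν.real Set.univ + (∫ x, (avg n (f ∘ x) - avg m (f ∘ x)) ^ 2 ∂ν) / δ) / 2 := by
          rw [integral_div, integral_add (integrable_const δ) (hsqi.div_const δ), integral_const,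
            integral_div, smul_eq_mul, mul_comm (ν.real Set.univ) δ]
      _ ≤ (δ * ν.real Set.univ + V / (n * δ)) / 2 := by
          rw [hsq]
          have h1 : (0 : ℝ) ≤ (n : ℝ)⁻¹ - (m : ℝ)⁻¹ := sub_nonneg.2 (by gcongr)
          have h2 : (n : ℝ)⁻¹ - (m : ℝ)⁻¹ ≤ (n : ℝ)⁻¹ := by
            have : (0 : ℝ) ≤ (m : ℝ)⁻¹ := by positivity
            linarith
          have h3 : (∫ x, f (x 0) * f (x 0) ∂ν - ∫ x, f (x 0) * f (x 1) ∂ν) *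
              ((n : ℝ)⁻¹ - (m : ℝ)⁻¹) ≤ V * (n : ℝ)⁻¹ :=
            mul_le_mul (le_abs_self _) h2 h1 (abs_nonneg _)
          have h4 : V / (n * δ) = V * (n : ℝ)⁻¹ / δ := by field_simp
          rw [h4]
          gcongr
  have hb1 : δ * ν.real Set.univ ≤ ε / 4 := by
    rw [hδ, div_mul_eq_mul_div, div_le_iff₀ (by positivity)]
    nlinarith
  have hb2 : V / (n * δ) ≤ ε / 4 := by
    have hNn : (N : ℝ) ≤ n := by exact_mod_cast (by omega : N ≤ n)
    have := (div_lt_iff₀ (by positivity)).1 (hN.trans_le hNn)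
    rw [div_le_iff₀ (by positivity)]
    nlinarith
  have hA := hν.integral_abs_avg_sub_avg_comp_le h0 hf hC
  have hAi : ∀ k, Integrable (fun x : ℕ → ℝ => |avg k x - avg k (f ∘ x)|) ν := fun k =>
    ((hν.integrable_avg h0 k).sub (integrable_avg_comp hf hC k)).abs
  have hBi : Integrable (fun x : ℕ → ℝ => |avg n (f ∘ x) - avg m (f ∘ x)|) ν :=
    ((integrable_avg_comp hf hC n).sub (integrable_avg_comp hf hC m)).abs
  have htri : ∫ x, |avg n x - avg m x| ∂ν ≤ ∫ x, |avg n x - avg n (f ∘ x)| ∂ν +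
      ∫ x, |avg n (f ∘ x) - avg m (f ∘ x)| ∂ν + ∫ x, |avg m x - avg m (f ∘ x)| ∂ν := by
    have hABi : Integrable (fun x : ℕ → ℝ => |avg n x - avg n (f ∘ x)| +
      |avg n (f ∘ x) - avg m (f ∘ x)|) ν := (hAi n).add hBi
    rw [← integral_add (hAi n) hBi, ← integral_add hABi (hAi m)]
    refine integral_mono_of_nonneg (ae_of_all _ fun x => abs_nonneg _)
      (hABi.add (hAi m)) (ae_of_all _ fun x => ?_)
    change |avg n x - avg m x| ≤ |avg n x - avg n (f ∘ x)| +
      |avg n (f ∘ x) - avg m (f ∘ x)| + |avg m x - avg m (f ∘ x)|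
    rw [abs_sub_comm (avg m x)]
    have h1 := abs_sub_le (avg n x) (avg n (f ∘ x)) (avg m x)
    have h2 := abs_sub_le (avg n (f ∘ x)) (avg m (f ∘ x)) (avg m x)
    linarith
  linarith [hA n, hA m]

/-- The strong law of large numbers for an exchangeable measure on `ℝ^∞`. The first three
clauses say that the limit is a version of the conditional expectation of the first coordinate given
the invariant `σ`-algebra; it is measurable for that `σ`-algebra as a function, not merely up to a
null set. -/
theorem IsExchangeable.strong_law (hν : IsExchangeable ν)
    (h0 : Integrable (fun x : ℕ → ℝ => x 0) ν) :
    ∃ Z : (ℕ → ℝ) → ℝ, Measurable[permInvariantSets] Z ∧ Integrable Z ν ∧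
      (∀ B, MeasurableSet[permInvariantSets] B → ∫ x in B, Z x ∂ν = ∫ x in B, x 0 ∂ν) ∧
      (∀ᵐ x ∂ν, Tendsto (fun n => avg n x) atTop (𝓝 (Z x))) ∧
      Tendsto (fun n => ∫ x, |avg n x - Z x| ∂ν) atTop (𝓝 0) := by
  have hA := hν.integrable_avg h0
  obtain ⟨G, hG, hGlim⟩ := exists_tendsto_integral_abs_sub hA
    fun ε hε => hν.exists_integral_abs_avg_sub_lt h0 hε
  obtain ⟨ns, hns, hae⟩ := exists_seq_ae_tendsto_of_integral hA hG hGlim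
  -- An upper limit, unlike a representative of the `L¹` limit, is an invariant function everywhere:
  -- a finite permutation changes only finitely many of the averages.
  let Z : (ℕ → ℝ) → ℝ := fun x => limsup (fun k => avg (ns k) x) atTop
  have hZm : Measurable[permInvariantSets] Z := by
    refine measurable_permInvariantSets (Measurable.limsup fun k => measurable_avg _)
      fun π hπ x => ?_
    obtain ⟨N, hN⟩ := hπ.bddAbove
    refine limsup_congr ?_
    filter_upwards [eventually_gt_atTop N] with k hk
    refine avg_comp_perm π (fun j hj => ?_) x
    exact (hN hj).trans_lt (hk.trans_le hns.le_apply)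
  have hZG : Z =ᵐ[ν] G := hae.mono fun x hx => hx.limsup_eq
  have hZ : Integrable Z ν := hG.congr hZG.symm
  have hL1 : Tendsto (fun n => ∫ x, |avg n x - Z x| ∂ν) atTop (𝓝 0) := by
    refine hGlim.congr fun n => integral_congr_ae ?_
    filter_upwards [hZG] with x hx
    rw [hx]
  refine ⟨Z, hZm, hZ, fun B hB => ?_, ?_, hL1⟩
  · have hlim : Tendsto (fun n => ∫ x in B, avg n x ∂ν) atTop (𝓝 (∫ x in B, Z x ∂ν)) := by
      rw [tendsto_iff_dist_tendsto_zero]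
      refine squeeze_zero (fun _ => dist_nonneg) (fun n => ?_) hL1
      rw [Real.dist_eq, ← integral_sub (hA n).integrableOn hZ.integrableOn]
      exact abs_integral_le_integral_abs.trans
        (setIntegral_le_integral ((hA n).sub hZ).abs (ae_of_all _ fun x => abs_nonneg _))
    refine tendsto_nhds_unique hlim (tendsto_const_nhds.congr' ?_)
    filter_upwards [eventually_gt_atTop 0] with n hn
    exact (hν.setIntegral_avg h0 hn (permInvariantSets_le_initial n B hB)).symm
  · have hcond : ∀ n, ν[fun x => x 0 - Z x | initialInvariantSets (n + 1)] =ᵐ[ν]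
        fun x => avg (n + 1) x - Z x := fun n => by
      have hZn : StronglyMeasurable[initialInvariantSets (n + 1)] Z :=
        (hZm.mono (permInvariantSets_le_initial _) le_rfl).stronglyMeasurable
      have h1 := condExp_sub h0 hZ (initialInvariantSets (n + 1))
      rw [condExp_of_stronglyMeasurable (initialInvariantSets_le _) hZn hZ] at h1
      refine h1.trans ?_
      filter_upwards [hν.condExp_coord_zero h0 n.succ_pos] with x hx
      rw [Pi.sub_apply, ← hx]
    have hrev := ae_tendsto_condExp_zero_of_integral (ν := ν)
      (𝓔 := fun n => initialInvariantSets (n + 1))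
      (fun a b hab => antitone_initialInvariantSets (by omega))
      (fun n => initialInvariantSets_le _) (fun x => x 0 - Z x) (by
        refine ((tendsto_add_atTop_iff_nat 1).2 hL1).congr fun n => integral_congr_ae ?_
        filter_upwards [hcond n] with x hx
        rw [hx])
    filter_upwards [hrev, ae_all_iff.2 hcond] with x hx hc
    have h2 : Tendsto (fun n => avg (n + 1) x - Z x) atTop (𝓝 0) := hx.congr hc
    rw [← tendsto_add_atTop_iff_nat 1]
    simpa using h2.add_const (Z x)

end StrongLaw

/-! ### Measures determined by absolute moments of affine forms -/

section CosineTransform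

/-- The right difference quotients of `t ↦ |t + y|` at `t = -a` are bounded by `1` and tend to `1` for
`y ≥ a` and to `-1` for `y < a`. -/
lemma tendsto_integral_abs_quotient (ρ : Measure ℝ) [IsFiniteMeasure ρ] (a : ℝ) :
    Tendsto (fun n : ℕ => ∫ y, ((n : ℝ) + 1) * (|(1 / ((n : ℝ) + 1) - a) + y| - |-a + y|) ∂ρ) atTop
      (𝓝 (2 * ρ.real (Set.Ici a) - ρ.real Set.univ)) := by
  have hval : ∫ y, ((Set.Ici a).indicator (fun _ => (2 : ℝ)) y - 1) ∂ρ =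
      2 * ρ.real (Set.Ici a) - ρ.real Set.univ := by
    rw [integral_sub ((integrable_const _).indicator measurableSet_Ici) (integrable_const _),
      integral_indicator_const _ measurableSet_Ici, integral_const]
    simp [mul_comm]
  rw [← hval]
  refine tendsto_integral_of_dominated_convergence (fun _ => 1) (fun n => ?_)
    (integrable_const _) (fun n => ae_of_all _ fun y => ?_) (ae_of_all _ fun y => ?_)
  · exact Measurable.aestronglyMeasurable (by fun_prop)
  · have hn : (0 : ℝ) < (n : ℝ) + 1 := by positivity
    rw [Real.norm_eq_abs, abs_mul, abs_of_pos hn]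
    have h1 := abs_abs_sub_abs_le (1 / ((n : ℝ) + 1) - a + y) (-a + y)
    have h2 : 1 / ((n : ℝ) + 1) - a + y - (-a + y) = 1 / ((n : ℝ) + 1) := by ring
    rw [h2, abs_of_pos (by positivity : (0 : ℝ) < 1 / ((n : ℝ) + 1))] at h1
    calc ((n : ℝ) + 1) * |(|1 / ((n : ℝ) + 1) - a + y| - |-a + y|)|
        ≤ ((n : ℝ) + 1) * (1 / ((n : ℝ) + 1)) := by gcongr
      _ = 1 := by field_simp
  · by_cases hy : a ≤ y
    · refine tendsto_const_nhds.congr fun n => ?_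
      have hn : (0 : ℝ) < (n : ℝ) + 1 := by positivity
      have hn' : (0 : ℝ) < 1 / ((n : ℝ) + 1) := by positivity
      rw [Set.indicator_of_mem (Set.mem_Ici.2 hy), abs_of_nonneg (by linarith),
        abs_of_nonneg (by linarith)]
      field_simp
      ring
    · push Not at hy
      obtain ⟨N, hN⟩ := exists_nat_one_div_lt (sub_pos.2 hy)
      refine tendsto_const_nhds.congr' ?_
      filter_upwards [eventually_ge_atTop N] with n hn
      have hn0 : (0 : ℝ) < (n : ℝ) + 1 := by positivity
      have hle : 1 / ((n : ℝ) + 1) ≤ 1 / ((N : ℝ) + 1) := by gcongr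
      rw [Set.indicator_of_notMem (by simpa using hy), abs_of_nonpos (by linarith),
        abs_of_nonpos (by linarith)]
      field_simp
      ring

/-- A finite measure on the line with first moment is determined by its mass and the integrals of
`|t + y|`. -/
lemma measure_ext_of_integral_abs_add {ρ σ : Measure ℝ} [IsFiniteMeasure ρ] [IsFiniteMeasure σ]
    (hρ : Integrable (fun y => y) ρ) (hσ : Integrable (fun y => y) σ)
    (hmass : ρ.real Set.univ = σ.real Set.univ)
    (h : ∀ t : ℝ, ∫ y, |t + y| ∂ρ = ∫ y, |t + y| ∂σ) : ρ = σ := by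
  refine Measure.ext_of_Ici _ _ fun a => ?_
  have hi : ∀ (τ : Measure ℝ) [IsFiniteMeasure τ], Integrable (fun y => y) τ → ∀ t : ℝ,
      Integrable (fun y => |t + y|) τ := fun τ _ hτ t => ((integrable_const t).add hτ).abs
  have hlim := tendsto_integral_abs_quotient ρ a
  have heq : ∀ n : ℕ, ∫ y, ((n : ℝ) + 1) * (|(1 / ((n : ℝ) + 1) - a) + y| - |-a + y|) ∂ρ =
      ∫ y, ((n : ℝ) + 1) * (|(1 / ((n : ℝ) + 1) - a) + y| - |-a + y|) ∂σ := fun n => by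
    rw [integral_const_mul, integral_const_mul, integral_sub (hi ρ hρ _) (hi ρ hρ _),
      integral_sub (hi σ hσ _) (hi σ hσ _), h, h]
  simp_rw [heq] at hlim
  have := tendsto_nhds_unique hlim (tendsto_integral_abs_quotient σ a)
  rw [← measureReal_eq_measureReal_iff]
  linarith

/-- An affine form of the injectivity of the cosine transform, reduced to the line by the
Cramér–Wold device. -/
lemma measure_ext_of_integral_abs_add_sum {ι : Type*} [Fintype ι] {ρ σ : Measure (ι → ℝ)}
    [IsFiniteMeasure ρ] [IsFiniteMeasure σ]
    (hρ : ∀ i, Integrable (fun x : ι → ℝ => x i) ρ) (hσ : ∀ i, Integrable (fun x : ι → ℝ => x i) σ)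
    (h : ∀ (t : ℝ) (u : ι → ℝ), ∫ x, |t + ∑ i, u i * x i| ∂ρ = ∫ x, |t + ∑ i, u i * x i| ∂σ) :
    ρ = σ := by
  classical
  refine Measure.ext_of_charFunDual (funext fun L => ?_)
  rw [charFunDual_eq_charFun_map_one, charFunDual_eq_charFun_map_one]
  congr 1
  have hL : ∀ x : ι → ℝ, L x = ∑ i, L (Pi.single i 1) * x i := fun x => by
    conv_lhs => rw [← Finset.univ_sum_single x]
    rw [map_sum]
    refine Finset.sum_congr rfl fun i _ => ?_
    have : Pi.single i (x i) = x i • (Pi.single i 1 : ι → ℝ) := by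
      rw [← Pi.single_smul, smul_eq_mul, mul_one]
    rw [this, map_smul, smul_eq_mul, mul_comm]
  have hLm : Measurable L := L.continuous.measurable
  have hint : ∀ τ : Measure (ι → ℝ), (∀ i, Integrable (fun x : ι → ℝ => x i) τ) →
      Integrable (fun y => y) (τ.map L) := fun τ hτ => by
    rw [integrable_map_measure (by fun_prop) hLm.aemeasurable]
    refine (integrable_finsetSum Finset.univ fun i _ =>
      (hτ i).const_mul (L (Pi.single i 1))).congr (ae_of_all _ fun x => ?_)
    exact (hL x).symm
  refine measure_ext_of_integral_abs_add (hint ρ hρ) (hint σ hσ) ?_ fun t => ?_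
  · rw [map_measureReal_apply hLm MeasurableSet.univ, map_measureReal_apply hLm MeasurableSet.univ]
    simp only [Set.preimage_univ]
    have h1 := h 1 0
    simp only [Pi.zero_apply, zero_mul, Finset.sum_const_zero, add_zero, abs_one, integral_const,
      smul_eq_mul, mul_one] at h1
    exact h1
  · rw [integral_map hLm.aemeasurable (by fun_prop), integral_map hLm.aemeasurable (by fun_prop)]
    have ht := h t fun i => L (Pi.single i 1)
    simp only [← hL] at ht
    exact ht

/-- The version for `ℝ^∞`; only the linear forms in at least `N₀` coordinates are needed, as unused
coordinates may have zero coefficients. -/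
lemma measure_ext_of_integral_abs_add_sum_range {ρ σ : Measure (ℕ → ℝ)}
    [IsFiniteMeasure ρ] [IsFiniteMeasure σ]
    (hρ : ∀ i, Integrable (fun x : ℕ → ℝ => x i) ρ) (hσ : ∀ i, Integrable (fun x : ℕ → ℝ => x i) σ)
    (N₀ : ℕ)
    (h : ∀ N ≥ N₀, ∀ (t : ℝ) (u : ℕ → ℝ), ∫ x, |t + ∑ i ∈ Finset.range N, u i * x i| ∂ρ =
      ∫ x, |t + ∑ i ∈ Finset.range N, u i * x i| ∂σ) :
    ρ = σ := by
  classical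
  have hproj : ∀ I : Finset ℕ, ρ.map I.restrict = σ.map I.restrict := by
    intro I
    have hIm : Measurable (I.restrict : (ℕ → ℝ) → I → ℝ) := Finset.measurable_restrict I
    have hint : ∀ τ : Measure (ℕ → ℝ), (∀ i, Integrable (fun x : ℕ → ℝ => x i) τ) →
        ∀ i, Integrable (fun x : I → ℝ => x i) (τ.map I.restrict) := fun τ hτ i => by
      rw [integrable_map_measure (measurable_pi_apply i).aestronglyMeasurable hIm.aemeasurable]
      exact hτ i
    refine measure_ext_of_integral_abs_add_sum (hint ρ hρ) (hint σ hσ) fun t u => ?_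
    have hm : ∀ τ : Measure (I → ℝ),
        AEStronglyMeasurable (fun x : I → ℝ => |t + ∑ i, u i * x i|) τ := fun τ =>
      Measurable.aestronglyMeasurable (by fun_prop)
    rw [integral_map hIm.aemeasurable (hm _), integral_map hIm.aemeasurable (hm _)]
    obtain ⟨M, hM⟩ := I.bddAbove
    let v : ℕ → ℝ := fun i => if hi : i ∈ I then u ⟨i, hi⟩ else 0
    have hv : ∀ x : ℕ → ℝ, ∑ i, u i * I.restrict x i =
        ∑ i ∈ Finset.range (max N₀ (M + 1)), v i * x i := by
      intro x
      have hsub : I ⊆ Finset.range (max N₀ (M + 1)) := fun i hi =>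
        Finset.mem_range.2 (lt_max_of_lt_right (Nat.lt_succ_of_le (hM hi)))
      rw [← Finset.sum_subset hsub fun i _ hi => by simp [v, hi], ← Finset.sum_coe_sort I]
      exact Finset.sum_congr rfl fun i _ => by simp [v]
    simp_rw [hv]
    exact h _ (le_max_left _ _) t v
  exact IsProjectiveLimit.unique (P := fun I : Finset ℕ => σ.map I.restrict)
    (fun I => hproj I) (fun I => rfl)

end CosineTransform

/-! ### The normalized sequence under the tilted measure -/

section Tilting

variable {Ω : Type*} [MeasurableSpace Ω] {μ : Measure Ω} {ξ : ℕ → Ω → ℝ}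

/-- The tilted measure `|ξ 0| · μ`; it is not normalised to total mass one. -/
noncomputable def tilted (ξ : ℕ → Ω → ℝ) (μ : Measure Ω) : Measure Ω :=
  μ.withDensity fun ω => ENNReal.ofReal |ξ 0 ω|

/-- The sequence `(ξ 1 / ξ 0, ξ 2 / ξ 0, …)`, which differs from the normalized sequence by the sign
of `ξ 0`. -/
noncomputable def ratioSequence (ξ : ℕ → Ω → ℝ) : ℕ → Ω → ℝ := fun i ω => ξ (i + 1) ω / ξ 0 ω

lemma measurable_ratioSequence (hmeas : ∀ i, Measurable (ξ i)) :
    Measurable fun ω i => ratioSequence ξ i ω :=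
  measurable_pi_lambda _ fun i => (hmeas (i + 1)).div (hmeas 0)

lemma measurable_normalizedSequence (hmeas : ∀ i, Measurable (ξ i)) :
    Measurable fun ω i => normalizedSequence ξ i ω :=
  measurable_pi_lambda _ fun i => (hmeas (i + 1)).div (hmeas 0).abs

lemma isFiniteMeasure_tilted (h0 : Integrable (ξ 0) μ) : IsFiniteMeasure (tilted ξ μ) :=
  isFiniteMeasure_withDensity_ofReal h0.abs.2

lemma integral_tilted (hmeas : ∀ i, Measurable (ξ i)) (g : Ω → ℝ) :
    ∫ ω, g ω ∂tilted ξ μ = ∫ ω, |ξ 0 ω| * g ω ∂μ := by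
  rw [tilted, integral_withDensity_eq_integral_toReal_smul (hmeas 0).abs.ennreal_ofReal
    (ae_of_all _ fun _ => ENNReal.ofReal_lt_top)]
  simp [ENNReal.toReal_ofReal]

lemma integrable_tilted_iff (hmeas : ∀ i, Measurable (ξ i)) (g : Ω → ℝ) :
    Integrable g (tilted ξ μ) ↔ Integrable (fun ω => |ξ 0 ω| * g ω) μ := by
  rw [tilted, integrable_withDensity_iff_integrable_smul' (hmeas 0).abs.ennreal_ofReal
    (ae_of_all _ fun _ => ENNReal.ofReal_lt_top)]
  simp [ENNReal.toReal_ofReal]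

/-- Swap-invariance for the vector of the first `M` variables and a transposition of two of them. -/
lemma SwapInvariant.integral_abs_sum_swap (h : SwapInvariant ξ μ) {M a b : ℕ} (ha : a < M)
    (hb : b < M) (v : ℕ → ℝ) :
    ∫ ω, |∑ i ∈ Finset.range M, v i * ξ (Equiv.swap a b i) ω| ∂μ =
      ∫ ω, |∑ i ∈ Finset.range M, v i * ξ i ω| ∂μ := by
  have hz := ((h.2 M (fun j => (j : ℕ)) Fin.val_strictMono).2
    (Equiv.swap ⟨a, ha⟩ ⟨b, hb⟩) 1).2.2 fun j => v j
  have hswap : ∀ j : Fin M, ((Equiv.swap (⟨a, ha⟩ : Fin M) ⟨b, hb⟩ j : Fin M) : ℕ) =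
      Equiv.swap a b (j : ℕ) := fun j => by
    simp only [Equiv.swap_apply_def, Fin.ext_iff]
    split_ifs <;> rfl
  simp only [dotProduct, hswap, Equiv.Perm.one_apply] at hz
  simp only [← Fin.sum_univ_eq_sum_range (fun i => v i * ξ (Equiv.swap a b i) _) M,
    ← Fin.sum_univ_eq_sum_range (fun i => v i * ξ i _) M]
  exact hz

lemma abs_mul_abs_add_sum_div {c : ℝ} (hc : c ≠ 0) (t : ℝ) (u y : ℕ → ℝ) (N : ℕ) :
    |c| * |t + ∑ i ∈ Finset.range N, u i * (y i / c)| =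
      |t * c + ∑ i ∈ Finset.range N, u i * y i| := by
  rw [← abs_mul, mul_add, Finset.mul_sum, mul_comm c t]
  congr 2
  refine Finset.sum_congr rfl fun i _ => ?_
  field_simp

lemma integrable_abs_mul_div (hmeas : ∀ i, Measurable (ξ i)) {i : ℕ} (hi : Integrable (ξ i) μ) :
    Integrable (fun ω => |ξ 0 ω| * (ξ i ω / ξ 0 ω)) μ := by
  refine hi.mono ((hmeas 0).abs.mul ((hmeas i).div (hmeas 0))).aestronglyMeasurable
    (ae_of_all _ fun ω => ?_)
  rw [norm_mul, norm_div, Real.norm_eq_abs, abs_abs, Real.norm_eq_abs, Real.norm_eq_abs]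
  by_cases hc : |ξ 0 ω| = 0
  · simp [hc]
  · rw [mul_div_cancel₀ _ hc]

/-- Under the tilted measure the ratios are exchangeable: the integrals of absolute values of affine
forms in the ratios are the integrals of absolute values of linear forms in `ξ`. -/
lemma isExchangeable_map_ratioSequence (hmeas : ∀ i, Measurable (ξ i)) (hswap : SwapInvariant ξ μ)
    (hne : ∀ᵐ ω ∂μ, ξ 0 ω ≠ 0) :
    IsExchangeable ((tilted ξ μ).map fun ω i => ratioSequence ξ i ω) := by
  intro a b
  have hfin := isFiniteMeasure_tilted (hswap.1 0)
  have hη := measurable_ratioSequence hmeas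
  have hs : Measurable fun x : ℕ → ℝ => x ∘ Equiv.swap a b := (swapEquiv a b).measurable
  have hint : ∀ i, Integrable (fun ω => ratioSequence ξ i ω) (tilted ξ μ) := fun i =>
    (integrable_tilted_iff hmeas _).2 (integrable_abs_mul_div hmeas (hswap.1 (i + 1)))
  rw [Measure.map_map hs hη]
  have hηs := hs.comp hη
  refine measure_ext_of_integral_abs_add_sum_range (fun i => ?_) (fun i => ?_) (max (a + 1) (b + 1))
    fun N hN t u => ?_
  · rw [integrable_map_measure (measurable_pi_apply i).aestronglyMeasurable hηs.aemeasurable]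
    exact hint (Equiv.swap a b i)
  · rw [integrable_map_measure (measurable_pi_apply i).aestronglyMeasurable hη.aemeasurable]
    exact hint i
  · have hm : ∀ τ : Measure (ℕ → ℝ),
        AEStronglyMeasurable (fun x : ℕ → ℝ => |t + ∑ i ∈ Finset.range N, u i * x i|) τ := fun τ =>
      Measurable.aestronglyMeasurable (by fun_prop)
    rw [integral_map hηs.aemeasurable (hm _), integral_map hη.aemeasurable (hm _),
      integral_tilted hmeas, integral_tilted hmeas]
    -- The coefficient `t` of the affine form becomes the coefficient of `ξ 0`.
    let v : ℕ → ℝ := fun i => Nat.casesOn i t u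
    have hv : ∀ y : ℕ → ℝ, ∑ i ∈ Finset.range (N + 1), v i * y i =
        t * y 0 + ∑ i ∈ Finset.range N, u i * y (i + 1) := fun y => by
      rw [Finset.sum_range_succ', add_comm]
      rfl
    have hsw : ∀ i, Equiv.swap (a + 1) (b + 1) (i + 1) = Equiv.swap a b i + 1 := fun i => by
      simp only [Equiv.swap_apply_def, add_left_inj]
      split_ifs <;> rfl
    have hsw0 : Equiv.swap (a + 1) (b + 1) 0 = 0 :=
      Equiv.swap_apply_of_ne_of_ne (by omega) (by omega)
    have key := hswap.integral_abs_sum_swap (M := N + 1) (a := a + 1) (b := b + 1)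
      (by have := le_max_left (a + 1) (b + 1); omega)
      (by have := le_max_right (a + 1) (b + 1); omega) v
    simp only [hv fun i => ξ (Equiv.swap (a + 1) (b + 1) i) _, hv fun i => ξ i _, hsw, hsw0] at key
    calc _ = ∫ ω, |t * ξ 0 ω + ∑ i ∈ Finset.range N, u i * ξ (Equiv.swap a b i + 1) ω| ∂μ := by
          refine integral_congr_ae ?_
          filter_upwards [hne] with ω hω
          exact abs_mul_abs_add_sum_div hω t u (fun i => ξ (Equiv.swap a b i + 1) ω) N
      _ = _ := key
      _ = _ := by
          refine integral_congr_ae ?_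
          filter_upwards [hne] with ω hω
          exact (abs_mul_abs_add_sum_div hω t u (fun i => ξ (i + 1) ω) N).symm

/-- Symmetry of `ξ` makes the normalized sequence symmetric under the tilted measure. -/
lemma SymmetricSequence.map_neg_normalizedSequence (hmeas : ∀ i, Measurable (ξ i))
    (hsymm : SymmetricSequence ξ μ) :
    (tilted ξ μ).map (fun ω i => -normalizedSequence ξ i ω) =
      (tilted ξ μ).map fun ω i => normalizedSequence ξ i ω := by
  have hn := measurable_normalizedSequence hmeas
  have hneg : Measurable fun ω i => -normalizedSequence ξ i ω :=
    measurable_pi_lambda _ fun i => (hn.eval (a := i)).neg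
  ext B hB
  let F : (ℕ → ℝ) → ℝ≥0∞ := fun x =>
    ENNReal.ofReal |x 0| * B.indicator 1 fun i => x (i + 1) / |x 0|
  have hF : Measurable F := by
    refine Measurable.mul (by fun_prop) ((measurable_one.indicator hB).comp ?_)
    fun_prop
  have hkey := (hsymm.comp hF).lintegral_eq
  have hind : ∀ (g : Ω → ℕ → ℝ), Measurable g →
      (tilted ξ μ).map g B = ∫⁻ ω, ENNReal.ofReal |ξ 0 ω| * B.indicator 1 (g ω) ∂μ := by
    intro g hg
    rw [← lintegral_indicator_one hB, lintegral_map (measurable_one.indicator hB) hg, tilted]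
    exact lintegral_withDensity_eq_lintegral_mul _ (hmeas 0).abs.ennreal_ofReal
      ((measurable_one.indicator hB).comp hg)
  rw [hind _ hneg, hind _ hn]
  refine Eq.trans (lintegral_congr fun ω => ?_) hkey.symm
  simp [F, normalizedSequence, neg_div]

/-- The normalized sequence inherits exchangeability from the ratios: by symmetry its law is the
symmetrization of theirs. -/
lemma isExchangeable_map_normalizedSequence (hmeas : ∀ i, Measurable (ξ i))
    (hsymm : SymmetricSequence ξ μ) (hswap : SwapInvariant ξ μ) (hne : ∀ᵐ ω ∂μ, ξ 0 ω ≠ 0) :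
    IsExchangeable ((tilted ξ μ).map fun ω i => normalizedSequence ξ i ω) := by
  have hn := measurable_normalizedSequence hmeas
  have hη := measurable_ratioSequence hmeas
  have hneg : Measurable fun x : ℕ → ℝ => -x := measurable_neg
  set ν := (tilted ξ μ).map fun ω i => normalizedSequence ξ i ω with hν
  set ρ := (tilted ξ μ).map fun ω i => ratioSequence ξ i ω with hρ
  have hρex : IsExchangeable ρ := isExchangeable_map_ratioSequence hmeas hswap hne
  have hνneg : ν.map (fun x => -x) = ν := by
    rw [hν, Measure.map_map hneg hn]
    exact hsymm.map_neg_normalizedSequence hmeas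
  have hsum : ν + ν.map (fun x => -x) = ρ + ρ.map fun x => -x := by
    ext B hB
    rw [Measure.add_apply, Measure.add_apply, hν, hρ, Measure.map_map hneg hn,
      Measure.map_map hneg hη]
    have hind : ∀ (g : Ω → ℕ → ℝ), Measurable g →
        (tilted ξ μ).map g B = ∫⁻ ω, B.indicator 1 (g ω) ∂tilted ξ μ := by
      intro g hg
      rw [← lintegral_indicator_one hB, lintegral_map (measurable_one.indicator hB) hg]
    have hBn : Measurable fun ω => B.indicator (1 : (ℕ → ℝ) → ℝ≥0∞)
      fun i => normalizedSequence ξ i ω := (measurable_one.indicator hB).comp hn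
    have hBη : Measurable fun ω => B.indicator (1 : (ℕ → ℝ) → ℝ≥0∞)
      fun i => ratioSequence ξ i ω := (measurable_one.indicator hB).comp hη
    rw [hind _ hn, hind _ hη, hind _ (hneg.comp hn), hind _ (hneg.comp hη),
      ← lintegral_add_left hBn, ← lintegral_add_left hBη]
    refine lintegral_congr fun ω => ?_
    rcases abs_choice (ξ 0 ω) with h | h
    · simp [normalizedSequence, ratioSequence, h]
    · have h1 : (fun i => normalizedSequence ξ i ω) = -fun i => ratioSequence ξ i ω := by
        ext i
        simp [normalizedSequence, ratioSequence, h, div_neg]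
      simp only [Function.comp_apply, h1, neg_neg]
      exact add_comm _ _
  intro a b
  have hs : Measurable fun x : ℕ → ℝ => x ∘ Equiv.swap a b := (swapEquiv a b).measurable
  have hcomm : ∀ τ : Measure (ℕ → ℝ), (τ.map fun x => -x).map (fun x => x ∘ Equiv.swap a b) =
      (τ.map fun x => x ∘ Equiv.swap a b).map fun x => -x := fun τ => by
    rw [Measure.map_map hs hneg, Measure.map_map hneg hs]
    rfl
  have h2 : ν.map (fun x => x ∘ Equiv.swap a b) + ν.map (fun x => x ∘ Equiv.swap a b) = ν + ν := by
    have := congrArg (Measure.map fun x => x ∘ Equiv.swap a b) hsum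
    rw [Measure.map_add _ _ hs, Measure.map_add _ _ hs, hcomm ρ, hρex a b, ← hsum, hνneg] at this
    exact this
  ext B hB
  have h3 := congrArg (fun τ : Measure (ℕ → ℝ) => τ B) h2
  simp only [Measure.add_apply, ← two_mul] at h3
  exact (ENNReal.mul_right_inj two_ne_zero ENNReal.ofNat_ne_top).1 h3

end Tilting

/-! ### Return to the original measure -/

section Limit

variable {Ω : Type*} {ξ : ℕ → Ω → ℝ}

lemma abs_mul_div_abs {c : ℝ} (hc : c ≠ 0) (y : ℝ) : |c| * (y / |c|) = y :=
  mul_div_cancel₀ y (abs_ne_zero.2 hc)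

/-- Separating the first summand expresses the averages of `ξ` through those of the normalized
sequence. -/
lemma inv_mul_sum_range_succ_eq {ω : Ω} (hω : ξ 0 ω ≠ 0) (n : ℕ) :
    ((n + 1 : ℕ) : ℝ)⁻¹ * ∑ i ∈ Finset.range (n + 1), ξ i ω =
      ((n : ℝ) + 1)⁻¹ * ξ 0 ω + (1 - ((n : ℝ) + 1)⁻¹) *
        (|ξ 0 ω| * avg n fun i => normalizedSequence ξ i ω) := by
  have hsum : |ξ 0 ω| * ∑ i ∈ Finset.range n, normalizedSequence ξ i ω =
      ∑ i ∈ Finset.range n, ξ (i + 1) ω := by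
    rw [Finset.mul_sum]
    exact Finset.sum_congr rfl fun i _ => abs_mul_div_abs hω _
  rw [Finset.sum_range_succ', avg, mul_left_comm |ξ 0 ω|, hsum]
  have hn : (n : ℝ) + 1 ≠ 0 := by positivity
  push_cast
  rcases Nat.eq_zero_or_pos n with rfl | hpos
  · simp
  · have hn' : (n : ℝ) ≠ 0 := by positivity
    field_simp
    ring

/-- A conditional expectation of an almost surely positive variable is almost surely positive: it
has a nonpositive integral over the event where it is nonpositive. -/
lemma ae_condExp_pos {m : MeasurableSpace Ω} {m0 : MeasurableSpace Ω} {μ : Measure Ω}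
    [IsFiniteMeasure μ] (hm : m ≤ m0) {w : Ω → ℝ} (hw : Integrable w μ) (hpos : ∀ᵐ ω ∂μ, 0 < w ω) :
    ∀ᵐ ω ∂μ, 0 < (μ[w | m]) ω := by
  let s : Set Ω := (μ[w | m]) ⁻¹' Set.Iic 0
  have hs : MeasurableSet[m] s :=
    stronglyMeasurable_condExp.measurable measurableSet_Iic
  have hnonneg : 0 ≤ᵐ[μ.restrict s] w := ae_restrict_of_ae (hpos.mono fun ω h => h.le)
  have hint : ∫ ω in s, w ω ∂μ ≤ 0 := by
    rw [← setIntegral_condExp hm hw hs]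
    exact setIntegral_nonpos (hm s hs) fun ω h => h
  have hzero := (integral_eq_zero_iff_of_nonneg_ae hnonneg hw.integrableOn).1
    (le_antisymm hint (integral_nonneg_of_ae hnonneg))
  rw [Filter.EventuallyEq, ae_restrict_iff' (hm s hs)] at hzero
  filter_upwards [hzero, hpos] with ω h1 h2
  by_contra h
  exact h2.ne' (h1 (not_lt.1 h))

variable [MeasurableSpace Ω] {μ : Measure Ω}

lemma exchangeableSigmaAlgebra_le (hmeas : ∀ i, Measurable (ξ i)) :
    exchangeableSigmaAlgebra (normalizedSequence ξ) ≤ (inferInstance : MeasurableSpace Ω) := by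
  rintro s ⟨B, hB, rfl⟩
  exact measurable_normalizedSequence hmeas hB.1

/-- The strong law with the limit in the form `|ξ 0| * z`, together with the equation that
identifies `z` as a ratio of conditional expectations. -/
lemma exists_strong_law_tilted [IsFiniteMeasure μ] (hmeas : ∀ i, Measurable (ξ i))
    (hsymm : SymmetricSequence ξ μ) (hswap : SwapInvariant ξ μ) (hne : ∀ᵐ ω ∂μ, ξ 0 ω ≠ 0) :
    ∃ z : Ω → ℝ, Integrable (fun ω => |ξ 0 ω| * z ω) μ ∧
      (z * μ[fun ω => |ξ 0 ω| | exchangeableSigmaAlgebra (normalizedSequence ξ)] =ᵐ[μ]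
        μ[ξ 1 | exchangeableSigmaAlgebra (normalizedSequence ξ)]) ∧
      (∀ᵐ ω ∂μ, Tendsto (fun n => avg n fun i => normalizedSequence ξ i ω) atTop (𝓝 (z ω))) ∧
      (∀ n, Integrable (fun ω => |ξ 0 ω| * |avg n (fun i => normalizedSequence ξ i ω) - z ω|) μ) ∧
      Tendsto (fun n => ∫ ω, |ξ 0 ω| * |avg n (fun i => normalizedSequence ξ i ω) - z ω| ∂μ)
        atTop (𝓝 0) := by
  have hn := measurable_normalizedSequence hmeas
  have hfin := isFiniteMeasure_tilted (hswap.1 0)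
  have hle := exchangeableSigmaAlgebra_le hmeas
  set ν := (tilted ξ μ).map fun ω i => normalizedSequence ξ i ω with hν
  have hνex : IsExchangeable ν := isExchangeable_map_normalizedSequence hmeas hsymm hswap hne
  have hcancel : (fun ω => |ξ 0 ω| * normalizedSequence ξ 0 ω) =ᵐ[μ] ξ 1 := by
    filter_upwards [hne] with ω hω
    exact abs_mul_div_abs hω _
  have h0 : Integrable (fun x : ℕ → ℝ => x 0) ν := by
    rw [hν, integrable_map_measure (measurable_pi_apply 0).aestronglyMeasurable hn.aemeasurable]
    exact (integrable_tilted_iff hmeas _).2 ((hswap.1 1).congr hcancel.symm)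
  obtain ⟨Z, hZm, hZ, hZB, hae, hL1⟩ := hνex.strong_law h0
  have hZm' : Measurable Z := hZm.mono permInvariantSets_le le_rfl
  let z : Ω → ℝ := fun ω => Z fun i => normalizedSequence ξ i ω
  have hzm : Measurable[exchangeableSigmaAlgebra (normalizedSequence ξ)] z :=
    fun s hs => ⟨Z ⁻¹' s, hZm hs, rfl⟩
  have hwz : Integrable (fun ω => |ξ 0 ω| * z ω) μ := by
    rw [← integrable_tilted_iff hmeas]
    exact hZ.comp_measurable hn
  have hset : ∀ (g : (ℕ → ℝ) → ℝ), Measurable g → ∀ B, MeasurableSet B →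
      ∫ x in B, g x ∂ν = ∫ ω in (fun ω i => normalizedSequence ξ i ω) ⁻¹' B,
        |ξ 0 ω| * g (fun i => normalizedSequence ξ i ω) ∂μ := by
    intro g hg B hB
    rw [← integral_indicator hB, hν, integral_map hn.aemeasurable
      (hg.indicator hB).aestronglyMeasurable, integral_tilted hmeas, ← integral_indicator (hn hB)]
    congr 1
    ext ω
    by_cases h : (fun i => normalizedSequence ξ i ω) ∈ B <;> simp [Set.indicator, h]
  have hcond1 : μ[z * fun ω => |ξ 0 ω| | exchangeableSigmaAlgebra (normalizedSequence ξ)] =ᵐ[μ]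
      μ[ξ 1 | exchangeableSigmaAlgebra (normalizedSequence ξ)] := by
    have hzw : Integrable (z * fun ω => |ξ 0 ω|) μ :=
      hwz.congr (ae_of_all _ fun ω => mul_comm _ _)
    refine ae_eq_condExp_of_forall_setIntegral_eq hle (hswap.1 1)
      (fun _ _ _ => integrable_condExp.integrableOn) ?_
      stronglyMeasurable_condExp.aestronglyMeasurable
    rintro s hs -
    rw [setIntegral_condExp hle hzw hs]
    obtain ⟨B, hB, rfl⟩ := hs
    calc _ = ∫ x in B, Z x ∂ν := by
          rw [hset Z hZm' B hB.1]
          exact integral_congr_ae (ae_of_all _ fun ω => mul_comm _ _)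
      _ = ∫ x in B, x 0 ∂ν := hZB B hB
      _ = _ := by
          rw [hset _ (measurable_pi_apply 0) B hB.1]
          exact integral_congr_ae (ae_restrict_of_ae hcancel)
  refine ⟨z, hwz, ?_, ?_, fun n => ?_, ?_⟩
  · refine EventuallyEq.trans ?_ hcond1
    exact (condExp_mul_of_stronglyMeasurable_left hzm.stronglyMeasurable
      (hwz.congr (ae_of_all _ fun ω => mul_comm _ _)) (hswap.1 0).abs).symm
  · have h1 := ae_of_ae_map hn.aemeasurable hae
    rw [tilted, ae_withDensity_iff (hmeas 0).abs.ennreal_ofReal] at h1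
    filter_upwards [h1, hne] with ω h2 hω
    exact h2 (by simpa using hω)
  · have h1 : Integrable (fun x => |avg n x - Z x|) ν := ((hνex.integrable_avg h0 n).sub hZ).abs
    exact (integrable_tilted_iff hmeas _).1 (h1.comp_measurable hn)
  · refine hL1.congr fun n => ?_
    have hm : Measurable fun x => |avg n x - Z x| := ((measurable_avg n).sub hZm').abs
    rw [hν, integral_map hn.aemeasurable hm.aestronglyMeasurable, integral_tilted hmeas]

end Limit

end Zonoid

theorem mainTheorem3 {Ω : Type*} [MeasurableSpace Ω] (μ : Measure Ω) [IsProbabilityMeasure μ]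
    (ξ : ℕ → Ω → ℝ) (hmeas : ∀ i, Measurable (ξ i))
    (hsymm : Zonoid.SymmetricSequence ξ μ) (hswap : Zonoid.SwapInvariant ξ μ)
    (hne : ∀ᵐ ω ∂μ, ξ 0 ω ≠ 0) :
    (∀ᵐ ω ∂μ, 0 < (μ[fun ω' => |ξ 0 ω'| |
        Zonoid.exchangeableSigmaAlgebra (Zonoid.normalizedSequence ξ)]) ω) ∧
    (∀ᵐ ω ∂μ, Tendsto (fun n : ℕ => (n : ℝ)⁻¹ * ∑ i ∈ Finset.range n, ξ i ω) atTop
        (𝓝 (Zonoid.ergodicLimit ξ μ ω))) ∧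
    Integrable (Zonoid.ergodicLimit ξ μ) μ ∧
    Tendsto (fun n : ℕ =>
        ∫ ω, |(n : ℝ)⁻¹ * ∑ i ∈ Finset.range n, ξ i ω - Zonoid.ergodicLimit ξ μ ω| ∂μ)
      atTop (𝓝 0) := by
  have hpos := Zonoid.ae_condExp_pos (Zonoid.exchangeableSigmaAlgebra_le hmeas) (hswap.1 0).abs
    (hne.mono fun ω h => abs_pos.2 h)
  obtain ⟨z, hwz, hz, hae, hint, hL1⟩ := Zonoid.exists_strong_law_tilted hmeas hsymm hswap hne
  have hlim : Zonoid.ergodicLimit ξ μ =ᵐ[μ] fun ω => |ξ 0 ω| * z ω := by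
    filter_upwards [hpos, hz] with ω h1 h2
    rw [Zonoid.ergodicLimit, ← h2, Pi.mul_apply]
    field_simp
  have hinv : Tendsto (fun n : ℕ => ((n : ℝ) + 1)⁻¹) atTop (𝓝 0) := by
    simpa using tendsto_one_div_add_atTop_nhds_zero_nat (𝕜 := ℝ)
  refine ⟨hpos, ?_, hwz.congr hlim.symm, ?_⟩
  · filter_upwards [hlim, hae, hne] with ω h1 h2 hω
    rw [h1, ← tendsto_add_atTop_iff_nat 1]
    simp_rw [Zonoid.inv_mul_sum_range_succ_eq hω]
    have := (hinv.mul_const (ξ 0 ω)).add ((hinv.const_sub 1).mul (h2.const_mul |ξ 0 ω|))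
    simpa using this
  · rw [← tendsto_add_atTop_iff_nat 1]
    have hbound : Tendsto (fun n : ℕ => ((n : ℝ) + 1)⁻¹ * ∫ ω, |ξ 0 ω| ∂μ +
        ∫ ω, |ξ 0 ω| * |Zonoid.avg n (fun i => Zonoid.normalizedSequence ξ i ω) - z ω| ∂μ +
        ((n : ℝ) + 1)⁻¹ * ∫ ω, |(|ξ 0 ω| * z ω)| ∂μ) atTop (𝓝 0) := by
      simpa using ((hinv.mul_const _).add hL1).add (hinv.mul_const _)
    refine squeeze_zero (fun n => integral_nonneg fun ω => abs_nonneg _) (fun n => ?_) hbound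
    have hi1 : Integrable (fun ω => ((n : ℝ) + 1)⁻¹ * |ξ 0 ω|) μ := (hswap.1 0).abs.const_mul _
    have hi3 : Integrable (fun ω => ((n : ℝ) + 1)⁻¹ * |(|ξ 0 ω| * z ω)|) μ := hwz.abs.const_mul _
    have hi12 : Integrable (fun ω => ((n : ℝ) + 1)⁻¹ * |ξ 0 ω| + |ξ 0 ω| *
      |Zonoid.avg n (fun i => Zonoid.normalizedSequence ξ i ω) - z ω|) μ := hi1.add (hint n)
    rw [← integral_const_mul, ← integral_const_mul, ← integral_add hi1 (hint n),
      ← integral_add hi12 hi3]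
    refine integral_mono_of_nonneg (ae_of_all _ fun ω => abs_nonneg _) (hi12.add hi3) ?_
    filter_upwards [hlim, hne] with ω h1 hω
    rw [h1, Zonoid.inv_mul_sum_range_succ_eq hω]
    set r := ((n : ℝ) + 1)⁻¹ with hr
    have hr0 : 0 ≤ r := by positivity
    have hr1 : r ≤ 1 := inv_le_one_of_one_le₀ (by linarith [(n.cast_nonneg : (0 : ℝ) ≤ n)])
    set A := Zonoid.avg n fun i => Zonoid.normalizedSequence ξ i ω
    have hsplit : r * ξ 0 ω + (1 - r) * (|ξ 0 ω| * A) - |ξ 0 ω| * z ω =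
        r * ξ 0 ω + (1 - r) * (|ξ 0 ω| * (A - z ω)) - r * (|ξ 0 ω| * z ω) := by ring
    rw [hsplit]
    refine (abs_sub _ _).trans (add_le_add ((abs_add_le _ _).trans (add_le_add ?_ ?_)) ?_)
    · rw [abs_mul, abs_of_nonneg hr0]
    · rw [abs_mul, abs_of_nonneg (by linarith : (0 : ℝ) ≤ 1 - r), abs_mul, abs_abs]
      exact mul_le_of_le_one_left (by positivity) (by linarith)
    · rw [abs_mul, abs_of_nonneg hr0]
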